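/- Let $\Delta$ be the modular discriminant, and for $\tau$ in the upper half-plane let $f(\tau)=\Delta(2\tau)/\Delta(\tau)$. For a function $g$ on the upper half-plane let $(Ug)(\tau)=\tfrac12\left(g\left(\tfrac{\tau}{2}\right)+g\left(\tfrac{\tau+1}{2}\right)\right)$; on $q$-expansions this is $\sum a_nq^n\mapsto\sum a_{2n}q^n$. Then, for all $\tau$, $$U(f)=24f+2^{11}f^2,\qquad f\left(\tfrac{\tau}{2}\right)f\left(\tfrac{\tau+1}{2}\right)=-f(\tau).$$ There are unique complex numbers $s_{i,j}$ ($i,j\in\mathbf Z_{\ge 0}$) such that, for every $j\ge 0$ and every $\tau$ in the upper half-plane, the series $\sum_{i\ge 0}s_{i,j}f(\tau)^i$ converges absolutely and $$U(f^j)(\tau)=\sum_{i=0}^{\infty}s_{i,j}f(\tau)^i .$$ The $s_{i,j}$ are integers and satisfy $$s_{i,j}=48\,s_{i-1,j-1}+2^{12}s_{i-2,j-1}+s_{i-1,j-2}\qquad(i,j\ge 2).$$ Moreover, for all $i,j\ge 1$ with $i\le 2j$ and $j\le 2i$, $$s_{i,j}=\frac{(i+j-1)!\cdot 3j\cdot 2^{8i-4j-1}}{(2i-j)!\,(2j-i)!}.$$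 -/

import Mathlib

open UpperHalfPlane ModularForm

open scoped Nat

/-- The point `2τ` of the upper half-plane. -/
noncomputable def twiceTau (τ : ℍ) : ℍ :=
  ⟨2 * (τ : ℂ), by simpa using τ.im_pos⟩

/-- The point `τ / 2` of the upper half-plane. -/
noncomputable def halfTau (τ : ℍ) : ℍ :=
  ⟨(τ : ℂ) / 2, by simpa using τ.im_pos⟩

/-- The point `(τ + 1) / 2` of the upper half-plane. -/
noncomputable def halfTauAddOne (τ : ℍ) : ℍ :=
  ⟨((τ : ℂ) + 1) / 2, by simpa using τ.im_pos⟩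

/-- The Hauptmodul `f(τ) = Δ(2τ) / Δ(τ)` of `X_0(2)`; the discriminant `Δ` has no zeros. -/
noncomputable def hauptmodul (τ : ℍ) : ℂ :=
  discriminant (twiceTau τ) / discriminant τ

/-- The operator `U = U_2` in weight zero, `(U g)(τ) = (g(τ/2) + g((τ+1)/2)) / 2`. On a convergent
`q`-expansion it is `∑ a_n q ^ n ↦ ∑ a_{2n} q ^ n`. -/
noncomputable def operatorU (g : ℍ → ℂ) : ℍ → ℂ :=
  fun τ => (g (halfTau τ) + g (halfTauAddOne τ)) / 2

/-- `s` is a system of coefficients of the functions `U(f ^ j)` as power series in `f`: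
`U(f ^ j) = ∑_i s_{i,j} f ^ i` on the upper half-plane, for every `j ≥ 0`. -/
def IsUCoeff (s : ℕ → ℕ → ℂ) : Prop :=
  ∀ (j : ℕ) (τ : ℍ),
    HasSum (fun i : ℕ => s i j * hauptmodul τ ^ i) (operatorU (hauptmodul ^ j) τ)

open Filter Topology MatrixGroups


/-! The values p = f(τ/2) and r = f((τ+1)/2) are Δ(τ)/Δ(τ/2) and Δ(τ)/Δ((τ+1)/2). Their product
comes from an identity of Euler products (`eulerProd_mul`). Their sum is the product times (Δ(τ/2) +
Δ((τ+1)/2))/Δ(τ), which is known because Δ spans the cusp forms of weight 12 and so is an eigenform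
of T_2 (`heckeTwoDelta_eq`).

Hence p and r are the roots of T² - (48f + 2¹²f²)T - f, and U(f^j), half a power sum of them, is an
integral polynomial in f obeying a two-term recurrence (`aeval_uPoly`). Uniqueness is the identity
theorem, since f is nonzero and tends to 0 at i∞.

For the closed form, put a = 2i - j, b = 2j - i and remove the factor 2^(4a-1). The recurrence
becomes the one with characteristic polynomial 1 - 3xy - x³ - y³, which 1 - x - y divides; so
binomial coefficients solve it, and C(a+b, a) + C(a+b-1, a) fits the initial values (`coeff_uPoly`).
-/

/-- Euler's product `∏ (1 - x ^ n) ^ 24`. -/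
noncomputable def eulerProd (x : ℂ) : ℂ := ∏' n : ℕ, (1 - x ^ (n + 1)) ^ 24

/-! ### Translation and inversion of η²⁴ -/

theorem eta_pow_eq_eulerProd {z : ℂ} (hz : 0 < z.im) :
    eta z ^ 24 = Complex.exp (2 * Real.pi * Complex.I * z) * eulerProd (Complex.exp (2 * Real.pi * Complex.I * z)) := by
  have h : Function.Periodic.qParam 1 z = Complex.exp (2 * Real.pi * Complex.I * z) := by
    simp [Function.Periodic.qParam]
  rw [← h]
  exact discriminant_eq_q_prod ⟨z, hz⟩

theorem eta_pow_add_one {z : ℂ} (hz : 0 < z.im) : eta (z + 1) ^ 24 = eta z ^ 24 := by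
  have h : Complex.exp (2 * Real.pi * Complex.I * (z + 1)) = Complex.exp (2 * Real.pi * Complex.I * z) := by
    rw [mul_add, mul_one, Complex.exp_add, Complex.exp_two_pi_mul_I, mul_one]
  rw [eta_pow_eq_eulerProd hz, eta_pow_eq_eulerProd (by simpa using hz), h]

theorem neg_inv_im_pos {z : ℂ} (hz : 0 < z.im) : 0 < (-z⁻¹).im := by
  have : z ≠ 0 := by rintro rfl; simp at hz
  have h2 := Complex.normSq_pos.mpr this
  rw [Complex.neg_im, Complex.inv_im]
  have : 0 < z.im / Complex.normSq z := by positivity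
  rw [neg_div, neg_neg]; exact this

theorem sqrt_pow_twentyFour {z : ℂ} (hz : z ≠ 0) : Complex.sqrt z ^ 24 = z ^ 12 := by
  rw [sqrt_eq_exp hz, ← Complex.exp_nat_mul,
    show ((24 : ℕ) : ℂ) * (Complex.log z / 2) = (12 : ℕ) * Complex.log z by push_cast; ring,
    Complex.exp_nat_mul, Complex.exp_log hz]

theorem eta_pow_neg_inv {z : ℂ} (hz : 0 < z.im) : eta (-z⁻¹) ^ 24 = z ^ 12 * eta z ^ 24 := by
  have hz0 : z ≠ 0 := by rintro rfl; simp at hz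
  have he : eta (-z⁻¹) = (Complex.sqrt Complex.I)⁻¹ * (Complex.sqrt z * eta z) := by
    simpa [neg_div] using eta_comp_eq_csqrt_I_inv (show z ∈ upperHalfPlaneSet from hz)
  rw [he, mul_pow, mul_pow, inv_pow, sqrt_pow_twentyFour hz0,
    sqrt_pow_twentyFour Complex.I_ne_zero, show (12 : ℕ) = 4 * 3 by norm_num, pow_mul Complex.I,
    Complex.I_pow_four]
  simp

/-! ### Δ as an eigenform of T_2 -/

/-- Twice the image of `Δ` under the Hecke operator `T_2`:
`2 ^ 12 Δ(2z) + Δ(z / 2) + Δ((z + 1) / 2)`. -/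
noncomputable def heckeTwoDelta (z : ℂ) : ℂ :=
  2 ^ 12 * eta (2 * z) ^ 24 + eta (z / 2) ^ 24 + eta ((z + 1) / 2) ^ 24

theorem heckeTwoDelta_add_one {z : ℂ} (hz : 0 < z.im) :
    heckeTwoDelta (z + 1) = heckeTwoDelta z := by
  unfold heckeTwoDelta
  have h1 : eta (2 * (z + 1)) ^ 24 = eta (2 * z) ^ 24 := by
    rw [show 2 * (z + 1) = 2 * z + 1 + 1 by ring, eta_pow_add_one (by simpa using hz),
      eta_pow_add_one (by simpa using hz)]
  have h2 : eta ((z + 1 + 1) / 2) ^ 24 = eta (z / 2) ^ 24 := by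
    rw [show (z + 1 + 1) / 2 = z / 2 + 1 by ring, eta_pow_add_one (by simpa using hz)]
  rw [h1, h2]; ring

theorem heckeTwoDelta_neg_inv {z : ℂ} (hz : 0 < z.im) :
    heckeTwoDelta (-z⁻¹) = z ^ 12 * heckeTwoDelta z := by
  have hz0 : z ≠ 0 := by rintro rfl; simp at hz
  unfold heckeTwoDelta
  have h1 : eta (2 * -z⁻¹) ^ 24 = (z / 2) ^ 12 * eta (z / 2) ^ 24 := by
    rw [← eta_pow_neg_inv (by simpa using hz)]
    congr 2; field_simp
  have h2 : eta (-z⁻¹ / 2) ^ 24 = (2 * z) ^ 12 * eta (2 * z) ^ 24 := by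
    rw [← eta_pow_neg_inv (by simpa using hz)]
    congr 2; field_simp
  have h3 : eta ((-z⁻¹ + 1) / 2) ^ 24 = z ^ 12 * eta ((z + 1) / 2) ^ 24 := by
    -- Translations and inversions suffice: u = v/z and -1/v = -1/u + 2.
    set u : ℂ := (-z⁻¹ + 1) / 2 with hu
    set v : ℂ := (z - 1) / 2 with hv
    have hu' : 0 < u.im := by simpa [hu] using neg_inv_im_pos hz
    have hv' : 0 < v.im := by simpa [hv] using hz
    have hv0 : v ≠ 0 := by intro h; simp [h] at hv'
    have huv : u = v / z := by rw [hu, hv]; field_simp; ring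
    have hz1 : z - 1 ≠ 0 := by intro h; rw [hv, h] at hv0; simp at hv0
    have h4 := eta_pow_neg_inv hu'
    have h5 := eta_pow_neg_inv hv'
    have h6 : eta (-v⁻¹) ^ 24 = eta (-u⁻¹) ^ 24 := by
      have : -v⁻¹ = -u⁻¹ + 1 + 1 := by rw [huv, hv]; field_simp; ring
      rw [this, eta_pow_add_one (by simpa using neg_inv_im_pos hu'),
        eta_pow_add_one (neg_inv_im_pos hu')]
    have h7 : eta ((z + 1) / 2) ^ 24 = eta v ^ 24 := by
      rw [← eta_pow_add_one hv']; congr 2; rw [hv]; ring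
    rw [h7]
    have h8 : u ^ 12 * eta u ^ 24 = v ^ 12 * eta v ^ 24 := by rw [← h4, ← h5, h6]
    rw [huv, div_pow, div_mul_eq_mul_div, div_eq_iff (pow_ne_zero _ hz0)] at h8
    have h9 : v ^ 12 ≠ 0 := pow_ne_zero _ hv0
    rw [huv]
    apply mul_left_cancel₀ h9
    rw [h8]; ring
  rw [h1, h2, h3]; ring

theorem tendsto_atImInfty_of_im {g : ℍ → ℍ} (hg : ∀ τ, τ.im / 2 ≤ (g τ).im) :
    Tendsto g atImInfty atImInfty := by
  rw [atImInfty, tendsto_comap_iff]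
  exact tendsto_atTop_mono hg (tendsto_comap.atTop_div_const two_pos)

theorem tendsto_twiceTau : Tendsto twiceTau atImInfty atImInfty :=
  tendsto_atImInfty_of_im fun τ => by
    have : (twiceTau τ).im = 2 * τ.im := by
      change (2 * (τ : ℂ)).im = _; simp
    rw [this]; linarith [τ.im_pos]

theorem tendsto_halfTau : Tendsto halfTau atImInfty atImInfty :=
  tendsto_atImInfty_of_im fun τ => by
    have : (halfTau τ).im = τ.im / 2 := by
      change ((τ : ℂ) / 2).im = _; simp
    rw [this]

theorem tendsto_halfTauAddOne : Tendsto halfTauAddOne atImInfty atImInfty :=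
  tendsto_atImInfty_of_im fun τ => by
    have : (halfTauAddOne τ).im = τ.im / 2 := by
      change (((τ : ℂ) + 1) / 2).im = _; simp
    rw [this]

theorem heckeTwoDelta_coe (τ : ℍ) : heckeTwoDelta τ =
    2 ^ 12 * discriminant (twiceTau τ) + discriminant (halfTau τ) +
      discriminant (halfTauAddOne τ) := rfl

theorem heckeTwoDelta_isZeroAtImInfty : IsZeroAtImInfty fun τ : ℍ => heckeTwoDelta τ := by
  have h := discriminant_isZeroAtImInfty
  have := (((h.comp tendsto_twiceTau).const_mul (2 ^ 12)).add (h.comp tendsto_halfTau)).add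
    (h.comp tendsto_halfTauAddOne)
  simpa [IsZeroAtImInfty, ZeroAtFilter] using! this

theorem heckeTwoDelta_slash (A : SL(2, ℤ)) :
    (fun τ : ℍ => heckeTwoDelta τ) ∣[(12 : ℤ)] A = fun τ : ℍ => heckeTwoDelta τ := by
  apply SlashInvariantForm.slash_action_generators_SL2Z
  · ext τ
    rw [SL_slash_apply, modular_S_smul]
    have h0 := τ.ne_zero
    have h := heckeTwoDelta_neg_inv τ.2
    rw [ModularGroup.denom_S, zpow_neg]
    change heckeTwoDelta (-(τ : ℂ))⁻¹ * _ = _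
    rw [inv_neg, h, mul_comm, ← mul_assoc, zpow_ofNat, inv_mul_cancel₀ (pow_ne_zero _ h0),
      one_mul]
  · ext τ
    rw [SL_slash_apply, modular_T_smul]
    have h := heckeTwoDelta_add_one τ.2
    have hd : denom ModularGroup.T τ = 1 := by
      rw [ModularGroup.denom_apply]
      simp [ModularGroup.T]
    rw [hd, one_zpow, mul_one, coe_vadd, Complex.ofReal_one, add_comm]
    exact h

/-- `heckeTwoDelta` as a cusp form of weight `12`. -/
noncomputable def heckeTwoCuspForm : CuspForm 𝒮ℒ 12 where
  toFun τ := heckeTwoDelta τ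
  slash_action_eq' A hA := by
    obtain ⟨A, rfl⟩ := hA
    exact heckeTwoDelta_slash A
  holo' := by
    rw [UpperHalfPlane.mdifferentiable_iff]
    have hd : DifferentiableOn ℂ heckeTwoDelta upperHalfPlaneSet := by
      intro z hz
      have hz' : 0 < z.im := hz
      have e (w : ℂ) (hw : 0 < w.im) : DifferentiableAt ℂ eta w :=
        differentiableAt_eta_of_mem_upperHalfPlaneSet hw
      have a1 : DifferentiableAt ℂ (fun z : ℂ => eta (2 * z)) z :=
        DifferentiableAt.comp (g := eta) (f := fun z : ℂ => 2 * z) z (e _ (by simpa using hz')) (by fun_prop)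
      have a2 : DifferentiableAt ℂ (fun z : ℂ => eta (z / 2)) z :=
        DifferentiableAt.comp (g := eta) (f := fun z : ℂ => z / 2) z (e _ (by simpa using hz')) (by fun_prop)
      have a3 : DifferentiableAt ℂ (fun z : ℂ => eta ((z + 1) / 2)) z :=
        DifferentiableAt.comp (g := eta) (f := fun z : ℂ => (z + 1) / 2) z (e _ (by simpa using hz')) (by fun_prop)
      exact ((((a1.pow 24).const_mul (2 ^ 12)).add (a2.pow 24)).add (a3.pow 24)).differentiableWithinAt
    refine hd.congr fun z hz => ?_
    simp [ofComplex_apply_of_im_pos hz]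
  zero_at_cusps' hc := by
    rw [Subgroup.IsArithmetic.isCusp_iff_isCusp_SL2Z] at hc
    rw [OnePoint.isZeroAt_iff_forall_SL2Z hc]
    intro γ _
    rw [heckeTwoDelta_slash]
    exact heckeTwoDelta_isZeroAtImInfty

theorem exists_heckeTwoDelta_eq : ∃ c : ℂ, ∀ τ : ℍ, heckeTwoDelta τ = c * discriminant τ := by
  obtain ⟨c, hc⟩ := CuspForm.exists_smul_discriminant_of_weight_eq_twelve heckeTwoCuspForm
  refine ⟨c, fun τ => ?_⟩
  have := DFunLike.congr_fun hc τ
  exact this.symm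

/-- Only the factor 1 - q contributes to the logarithmic derivative at 0. This supplies τ(2) = -24.
-/
theorem hasDerivAt_eulerProd_zero : HasDerivAt eulerProd (-24) 0 := by
  have hmem : (0 : ℂ) ∈ Metric.ball (0 : ℂ) 1 := Metric.mem_ball_self one_pos
  have hd : DifferentiableAt ℂ (fun q : ℂ => ∏' n : ℕ, (1 - q ^ (n + 1))) 0 :=
    differentiableOn_tprod_one_sub_pow.differentiableAt (Metric.isOpen_ball.mem_nhds hmem)
  have hlog : logDeriv (fun q : ℂ => ∏' n : ℕ, (1 - q ^ (n + 1))) 0 = -1 := by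
    have hl (i : ℕ) : logDeriv (fun q : ℂ => 1 - q ^ (i + 1)) 0 = if i = 0 then -1 else 0 := by
      rcases i with _ | i <;> simp [logDeriv]
    rw [logDeriv_tprod_eq_tsum (f := fun (n : ℕ) (q : ℂ) => 1 - q ^ (n + 1)) Metric.isOpen_ball hmem]
    · simp [hl]
    · simp
    · intro i; fun_prop
    · simp only [hl]
      exact (hasSum_ite_eq 0 (-1 : ℂ)).summable
    · exact multipliableLocallyUniformlyOn_one_sub_pow
    · simp
  have h1 : HasDerivAt (fun q : ℂ => ∏' n : ℕ, (1 - q ^ (n + 1))) (-1) 0 := by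
    have := hd.hasDerivAt
    simp [logDeriv] at hlog
    rwa [hlog] at this
  have h2 := h1.pow 24
  have h3 : eulerProd =ᶠ[𝓝 0] (fun q : ℂ => (∏' n : ℕ, (1 - q ^ (n + 1))) ^ 24) := by
    filter_upwards [Metric.isOpen_ball.mem_nhds hmem] with q hq
    exact (multipliable_one_sub_pow (by simpa using hq)).tprod_pow 24
  refine HasDerivAt.congr_of_eventuallyEq ?_ h3
  simpa [Pi.pow_def] using h2

theorem exists_exp_pi_mul_I_eq {x : ℂ} (hx0 : x ≠ 0) (hx : ‖x‖ < 1) :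
    ∃ τ : ℍ, Complex.exp (Real.pi * Complex.I * τ) = x := by
  have := Function.Periodic.im_invQParam_pos_of_norm_lt_one (h := 2) two_pos hx hx0
  refine ⟨⟨_, this⟩, ?_⟩
  have h2 := Function.Periodic.qParam_right_inv (h := 2) two_ne_zero hx0
  rw [Function.Periodic.qParam] at h2
  refine Eq.trans ?_ h2
  congr 1
  change Real.pi * Complex.I * Function.Periodic.invQParam 2 x = _
  push_cast
  ring

theorem eulerProd_expansions (τ : ℍ) :
    discriminant τ = Complex.exp (Real.pi * Complex.I * τ) ^ 2 * eulerProd (Complex.exp (Real.pi * Complex.I * τ) ^ 2) ∧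
    discriminant (twiceTau τ) = Complex.exp (Real.pi * Complex.I * τ) ^ 4 * eulerProd (Complex.exp (Real.pi * Complex.I * τ) ^ 4) ∧
    discriminant (halfTau τ) = Complex.exp (Real.pi * Complex.I * τ) * eulerProd (Complex.exp (Real.pi * Complex.I * τ)) ∧
    discriminant (halfTauAddOne τ) =
      -Complex.exp (Real.pi * Complex.I * τ) * eulerProd (-Complex.exp (Real.pi * Complex.I * τ)) := by
  have key (σ : ℍ) : discriminant σ = _ := eta_pow_eq_eulerProd σ.2
  have h1 : Complex.exp (2 * Real.pi * Complex.I * (twiceTau τ : ℂ)) = Complex.exp (Real.pi * Complex.I * τ) ^ 4 := by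
    rw [← Complex.exp_nat_mul]
    change Complex.exp (2 * Real.pi * Complex.I * (2 * (τ : ℂ))) = _
    congr 1; push_cast; ring
  have h2 : Complex.exp (2 * Real.pi * Complex.I * (halfTau τ : ℂ)) = Complex.exp (Real.pi * Complex.I * τ) := by
    change Complex.exp (2 * Real.pi * Complex.I * ((τ : ℂ) / 2)) = _
    congr 1; ring
  have h3 : Complex.exp (2 * Real.pi * Complex.I * (halfTauAddOne τ : ℂ)) = -Complex.exp (Real.pi * Complex.I * τ) := by
    change Complex.exp (2 * Real.pi * Complex.I * (((τ : ℂ) + 1) / 2)) = _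
    rw [show 2 * Real.pi * Complex.I * (((τ : ℂ) + 1) / 2) = Real.pi * Complex.I * τ + Real.pi * Complex.I by ring,
      Complex.exp_add, Complex.exp_pi_mul_I]
    ring
  have h4 : Complex.exp (2 * Real.pi * Complex.I * (τ : ℂ)) = Complex.exp (Real.pi * Complex.I * τ) ^ 2 := by
    rw [← Complex.exp_nat_mul]
    congr 1; push_cast; ring
  refine ⟨?_, ?_, ?_, ?_⟩
  · rw [key τ, ← h4]
  · rw [key, ← h1]
  · rw [key, ← h2]
  · rw [key, ← h3]

/-- With x = exp(πiτ) and P Euler's product, the eigenvalue relation is x(P(x) - P(-x)) + 2¹²x⁴P(x⁴)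
= c x²P(x²). Dividing by x² and letting x → 0 gives c = 2P'(0). -/
theorem heckeTwoDelta_eq (τ : ℍ) : heckeTwoDelta τ = -48 * discriminant τ := by
  obtain ⟨c, hc⟩ := exists_heckeTwoDelta_eq
  have hP := hasDerivAt_eulerProd_zero
  have hP0 : eulerProd 0 = 1 := by simp [eulerProd]
  have hQ : HasDerivAt (fun x => eulerProd x - eulerProd (-x)) (-48) 0 := by
    have h1 : HasDerivAt (fun x : ℂ => eulerProd (-x)) (-24 * -1) 0 :=
      HasDerivAt.comp (h₂ := eulerProd) (h := fun x : ℂ => -x) 0 (by simpa using hP) (hasDerivAt_neg 0)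
    convert! hP.sub h1 using 1
    norm_num
  have hlim := hasDerivAt_iff_tendsto_slope_zero.mp hQ
  have hcont (n : ℕ) (hn : n ≠ 0) : Tendsto (fun x : ℂ => eulerProd (x ^ n)) (𝓝[≠] 0) (𝓝 1) := by
    have : Tendsto (fun x : ℂ => x ^ n) (𝓝[≠] 0) (𝓝 0) := by
      have h := (continuous_pow (M := ℂ) n).tendsto 0
      rw [zero_pow hn] at h
      exact h.mono_left nhdsWithin_le_nhds
    have h2 := hP.continuousAt.tendsto.comp this
    rwa [hP0] at h2
  have hsq : Tendsto (fun x : ℂ => 4096 * x ^ 2) (𝓝[≠] 0) (𝓝 0) := by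
    have h : Tendsto (fun x : ℂ => 4096 * x ^ 2) (𝓝 0) (𝓝 (4096 * 0 ^ 2)) :=
      Continuous.tendsto (by fun_prop) 0
    simp only [ne_eq, OfNat.ofNat_ne_zero, not_false_eq_true, zero_pow, mul_zero] at h
    exact h.mono_left nhdsWithin_le_nhds
  have hleft := hlim.add (hsq.mul (hcont 4 (by norm_num)))
  have hright := (hcont 2 (by norm_num)).const_mul c
  have heq : (fun x : ℂ => c * eulerProd (x ^ 2)) =ᶠ[𝓝[≠] 0]
      (fun x : ℂ => x⁻¹ • ((eulerProd (0 + x) - eulerProd (-(0 + x))) -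
        (eulerProd 0 - eulerProd (-0))) + 4096 * x ^ 2 * eulerProd (x ^ 4)) := by
    have hball : Metric.ball (0 : ℂ) 1 ∈ 𝓝[≠] (0 : ℂ) :=
      nhdsWithin_le_nhds (Metric.ball_mem_nhds 0 one_pos)
    filter_upwards [hball, self_mem_nhdsWithin] with x hx hx0
    have hx0 : x ≠ 0 := hx0
    obtain ⟨σ, hσ⟩ := exists_exp_pi_mul_I_eq hx0 (by simpa using hx)
    have h1 := hc σ
    obtain ⟨e1, e2, e3, e4⟩ := eulerProd_expansions σ
    rw [heckeTwoDelta_coe, e1, e2, e3, e4, hσ] at h1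
    simp only [zero_add, neg_zero, sub_self, sub_zero, smul_eq_mul]
    field_simp
    apply mul_left_cancel₀ hx0
    linear_combination -h1
  have := tendsto_nhds_unique (hright.congr' heq) hleft
  have hc' : c = -48 := by simpa using this
  rw [hc, hc']

/-! ### The Euler product identity -/

theorem multipliable_one_sub_pow_odd {x : ℂ} (hx : ‖x‖ < 1) :
    Multipliable fun n : ℕ => 1 - x ^ (2 * n + 1) := by
  simp_rw [sub_eq_add_neg]
  apply multipliable_one_add_of_summable
  simp only [norm_neg, norm_pow]
  exact (summable_geometric_of_lt_one (norm_nonneg _) hx).comp_injective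
    (i := fun n : ℕ => 2 * n + 1) fun a b h => by simpa using h

theorem tprod_one_sub_pow_eq_odd_mul {x : ℂ} (hx : ‖x‖ < 1) :
    ∏' n : ℕ, (1 - x ^ (n + 1)) =
      (∏' n : ℕ, (1 - x ^ (2 * n + 1))) * ∏' n : ℕ, (1 - (x ^ 2) ^ (n + 1)) := by
  have hx2 : ‖x ^ 2‖ < 1 := by rw [norm_pow]; exact pow_lt_one₀ (norm_nonneg _) hx two_ne_zero
  have h2 := (multipliable_one_sub_pow hx2).hasProd
  simp_rw [← pow_mul, mul_add, mul_one] at h2 ⊢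
  exact (HasProd.even_mul_odd (f := fun n : ℕ => 1 - x ^ (n + 1))
    (multipliable_one_sub_pow_odd hx).hasProd h2).tprod_eq

/-- For odd m, (1 - x^m)(1 + x^m) = 1 - x^(2m), so the odd-index products at x and -x multiply to
the one at x²; the even-index factors form the full product at x². -/
theorem eulerProd_mul {x : ℂ} (hx : ‖x‖ < 1) :
    eulerProd x * eulerProd (-x) * eulerProd (x ^ 4) = eulerProd (x ^ 2) ^ 3 := by
  have hx2 : ‖x ^ 2‖ < 1 := by rw [norm_pow]; exact pow_lt_one₀ (norm_nonneg _) hx two_ne_zero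
  have hx4 : ‖x ^ 4‖ < 1 := by rw [norm_pow]; exact pow_lt_one₀ (norm_nonneg _) hx four_ne_zero
  have hxn : ‖-x‖ < 1 := by rwa [norm_neg]
  have hodd : (∏' n : ℕ, (1 - x ^ (2 * n + 1))) * ∏' n : ℕ, (1 - (-x) ^ (2 * n + 1)) =
      ∏' n : ℕ, (1 - (x ^ 2) ^ (2 * n + 1)) := by
    rw [← (multipliable_one_sub_pow_odd hx).tprod_mul (multipliable_one_sub_pow_odd hxn)]
    refine tprod_congr fun n => ?_
    rw [(odd_two_mul_add_one n).neg_pow]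
    ring
  have e (y : ℂ) (hy : ‖y‖ < 1) : eulerProd y = (∏' n : ℕ, (1 - y ^ (n + 1))) ^ 24 :=
    (multipliable_one_sub_pow hy).tprod_pow 24
  have h1 := tprod_one_sub_pow_eq_odd_mul hx
  have h2 := tprod_one_sub_pow_eq_odd_mul hxn
  have h3 := tprod_one_sub_pow_eq_odd_mul hx2
  rw [neg_sq] at h2
  rw [← pow_mul] at h3
  rw [e _ hx, e _ hxn, e _ hx2, e _ hx4, ← mul_pow, ← mul_pow, ← pow_mul, mul_comm 24 3, pow_mul]
  congr 1
  rw [h1, h2]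
  linear_combination (∏' n : ℕ, (1 - (x ^ 2) ^ (n + 1))) ^ 2 *
    ((∏' n : ℕ, (1 - (x ^ 4) ^ (n + 1))) * hodd - h3)

theorem norm_exp_pi_mul_I_lt_one (τ : ℍ) : ‖Complex.exp (Real.pi * Complex.I * τ)‖ < 1 := by
  rw [Complex.norm_exp, Real.exp_lt_one_iff]
  have := mul_pos Real.pi_pos τ.im_pos
  simpa using this

theorem discriminant_mul (τ : ℍ) : discriminant (halfTau τ) * discriminant (halfTauAddOne τ) *
    discriminant (twiceTau τ) = -discriminant τ ^ 3 := by
  obtain ⟨e1, e2, e3, e4⟩ := eulerProd_expansions τ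
  rw [e1, e2, e3, e4]
  linear_combination (-(Complex.exp (Real.pi * Complex.I * τ)) ^ 6) *
    eulerProd_mul (norm_exp_pi_mul_I_lt_one τ)

/-! ### Sum and product of f(τ/2) and f((τ+1)/2) -/

theorem hauptmodul_halfTau (τ : ℍ) :
    hauptmodul (halfTau τ) = discriminant τ / discriminant (halfTau τ) := by
  have : twiceTau (halfTau τ) = τ := by
    ext; change 2 * ((τ : ℂ) / 2) = _; ring
  rw [hauptmodul, this]

theorem hauptmodul_halfTauAddOne (τ : ℍ) :
    hauptmodul (halfTauAddOne τ) = discriminant τ / discriminant (halfTauAddOne τ) := by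
  have : discriminant (twiceTau (halfTauAddOne τ)) = discriminant τ := by
    change eta (2 * (((τ : ℂ) + 1) / 2)) ^ 24 = _
    rw [mul_div_cancel₀ _ (two_ne_zero' ℂ), eta_pow_add_one τ.2]; rfl
  rw [hauptmodul, this]

theorem hauptmodul_ne_zero (τ : ℍ) : hauptmodul τ ≠ 0 :=
  div_ne_zero (discriminant_ne_zero _) (discriminant_ne_zero _)

theorem hauptmodul_halfTau_mul (τ : ℍ) :
    hauptmodul (halfTau τ) * hauptmodul (halfTauAddOne τ) = -hauptmodul τ := by
  have h := discriminant_mul τ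
  have h0 := discriminant_ne_zero τ
  have h1 := discriminant_ne_zero (halfTau τ)
  have h2 := discriminant_ne_zero (halfTauAddOne τ)
  rw [hauptmodul_halfTau, hauptmodul_halfTauAddOne, hauptmodul]
  field_simp
  linear_combination h

theorem operatorU_hauptmodul (τ : ℍ) :
    operatorU hauptmodul τ = 24 * hauptmodul τ + 2 ^ 11 * hauptmodul τ ^ 2 := by
  have h0 := discriminant_ne_zero τ
  have h1 := discriminant_ne_zero (halfTau τ)
  have h2 := discriminant_ne_zero (halfTauAddOne τ)
  have hV := heckeTwoDelta_eq τ
  rw [heckeTwoDelta_coe] at hV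
  have hsum : hauptmodul (halfTau τ) + hauptmodul (halfTauAddOne τ) =
      hauptmodul (halfTau τ) * hauptmodul (halfTauAddOne τ) *
        ((discriminant (halfTau τ) + discriminant (halfTauAddOne τ)) / discriminant τ) := by
    rw [hauptmodul_halfTau, hauptmodul_halfTauAddOne]
    field_simp
    ring
  have hq : (discriminant (halfTau τ) + discriminant (halfTauAddOne τ)) / discriminant τ =
      -48 - 2 ^ 12 * hauptmodul τ := by
    rw [hauptmodul]
    field_simp
    linear_combination hV
  rw [hauptmodul_halfTau_mul, hq] at hsum
  rw [operatorU, hsum]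
  ring

theorem tendsto_hauptmodul : Tendsto hauptmodul atImInfty (𝓝 0) := by
  have h1 : Tendsto (fun τ : ℍ => Complex.exp (Real.pi * Complex.I * τ)) atImInfty (𝓝 0) := by
    have := qParam_tendsto_atImInfty (h := 2) two_pos
    refine this.congr fun τ => ?_
    rw [Function.Periodic.qParam]
    congr 1; push_cast; ring
  have hP : Tendsto eulerProd (𝓝 0) (𝓝 1) := by
    have := hasDerivAt_eulerProd_zero.continuousAt.tendsto
    simpa [eulerProd] using this
  have hn (n : ℕ) (hn : n ≠ 0) :
      Tendsto (fun τ : ℍ => Complex.exp (Real.pi * Complex.I * τ) ^ n) atImInfty (𝓝 0) := by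
    simpa [hn] using h1.pow n
  have h := ((hn 2 two_ne_zero).mul (hP.comp (hn 4 four_ne_zero))).div (hP.comp (hn 2 two_ne_zero))
    one_ne_zero
  simp only [zero_mul, zero_div] at h
  refine h.congr fun τ => ?_
  obtain ⟨e1, e2, -, -⟩ := eulerProd_expansions τ
  have h0 := discriminant_ne_zero τ
  rw [e1] at h0
  have hP0 : eulerProd (Complex.exp (Real.pi * Complex.I * τ) ^ 2) ≠ 0 := right_ne_zero_of_mul h0
  rw [hauptmodul, e1, e2]
  simp only [Function.comp, Pi.div_apply]
  field_simp


/-! ### Power sums as polynomials in f -/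

/-- The polynomial `S_j` with `U (f ^ j) = S_j(f)`. -/
noncomputable def uPoly : ℕ → Polynomial ℤ
  | 0 => 1
  | 1 => 24 * Polynomial.X + 2 ^ 11 * Polynomial.X ^ 2
  | j + 2 => (48 * Polynomial.X + 2 ^ 12 * Polynomial.X ^ 2) * uPoly (j + 1) +
      Polynomial.X * uPoly j

/-- Newton's recurrence: p^(j+2) + r^(j+2) = (p + r)(p^(j+1) + r^(j+1)) - pr(p^j + r^j). -/
theorem aeval_uPoly {x p r : ℂ} (hadd : (p + r) / 2 = 24 * x + 2 ^ 11 * x ^ 2)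
    (hmul : p * r = -x) (j : ℕ) :
    Polynomial.aeval x (uPoly j) = (p ^ j + r ^ j) / 2 := by
  induction j using Nat.twoStepInduction with
  | zero => simp [uPoly]
  | one =>
    simp only [uPoly, map_add, map_mul, map_pow, Polynomial.aeval_X, map_ofNat, pow_one, hadd]
  | more j h0 h1 =>
    simp only [uPoly, map_add, map_mul, map_pow, Polynomial.aeval_X, h0, h1, map_ofNat]
    linear_combination (-(p ^ (j + 1) + r ^ (j + 1))) * hadd + ((p ^ j + r ^ j) / 2) * hmul

theorem coeff_uPoly_add_two (i j : ℕ) : (uPoly (j + 2)).coeff (i + 2) =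
    48 * (uPoly (j + 1)).coeff (i + 1) + 2 ^ 12 * (uPoly (j + 1)).coeff i +
      (uPoly j).coeff (i + 1) := by
  have h : uPoly (j + 2) = Polynomial.C 48 * (Polynomial.X * uPoly (j + 1)) +
      Polynomial.C (2 ^ 12) * (Polynomial.X ^ 2 * uPoly (j + 1)) + Polynomial.X * uPoly j := by
    simp only [uPoly, map_pow, map_ofNat]; ring
  rw [h, Polynomial.coeff_add, Polynomial.coeff_add, Polynomial.coeff_C_mul,
    Polynomial.coeff_C_mul, Polynomial.coeff_X_mul, Polynomial.coeff_X_pow_mul,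
    Polynomial.coeff_X_mul]

theorem coeff_uPoly_add_two_one (j : ℕ) : (uPoly (j + 2)).coeff 1 =
    48 * (uPoly (j + 1)).coeff 0 + (uPoly j).coeff 0 := by
  have h : uPoly (j + 2) = Polynomial.X * (Polynomial.C 48 * uPoly (j + 1) +
      Polynomial.X * (Polynomial.C (2 ^ 12) * uPoly (j + 1)) + uPoly j) := by
    simp only [uPoly, map_pow, map_ofNat]; ring
  rw [h, Polynomial.coeff_X_mul]
  simp

theorem coeff_uPoly_add_one_zero (j : ℕ) : (uPoly (j + 1)).coeff 0 = 0 := by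
  rcases j with _ | j <;> simp [uPoly]

theorem hasSum_coeff_mul_pow (p : Polynomial ℤ) (x : ℂ) :
    HasSum (fun i => ((p.coeff i : ℤ) : ℂ) * x ^ i) (Polynomial.aeval x p) := by
  rw [Polynomial.aeval_eq_sum_range]
  simp only [zsmul_eq_mul]
  refine hasSum_sum_of_ne_finset_zero fun i hi => ?_
  rw [Polynomial.coeff_eq_zero_of_natDegree_lt (by simpa using hi)]
  simp

/-! ### Uniqueness of the coefficients -/

/-- A power series vanishing on nonzero points accumulating at `0` has zero coefficients. -/
theorem eq_zero_of_hasSum_of_frequently {ι : Type*} {l : Filter ι} [l.NeBot] {g : ι → ℂ}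
    (hg : Tendsto g l (𝓝 0)) (hg0 : ∀ x, g x ≠ 0) {d : ℕ → ℂ}
    (hd : ∀ x, HasSum (fun i => d i * g x ^ i) 0) : d = 0 := by
  obtain ⟨x₀⟩ : Nonempty ι := l.nonempty_of_neBot
  set p : FormalMultilinearSeries ℂ ℂ ℂ := FormalMultilinearSeries.ofScalars ℂ d with hp
  have hpos : 0 < p.radius := by
    -- Convergence at the single nonzero point `g x₀` already forces a positive radius.
    have hle : (‖g x₀‖₊ : ENNReal) ≤ p.radius := by
      refine p.le_radius_of_tendsto (l := 0) ?_
      have h1 := (hd x₀).summable.tendsto_atTop_zero.norm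
      simp only [norm_zero, norm_mul, norm_pow] at h1
      simpa [hp, FormalMultilinearSeries.ofScalars_norm] using h1
    refine lt_of_lt_of_le ?_ hle
    simpa using hg0 x₀
  have hps := p.hasFPowerSeriesOnBall hpos
  have hsum (x : ι) : p.sum (g x) = 0 := by
    rw [hp, FormalMultilinearSeries.sum]
    simpa [FormalMultilinearSeries.ofScalars_apply_eq, mul_comm] using (hd x).tsum_eq
  have hfreq : ∃ᶠ z in 𝓝[≠] (0 : ℂ), p.sum z = 0 := by
    have ht : Tendsto g l (𝓝[≠] 0) :=
      tendsto_nhdsWithin_iff.mpr ⟨hg, Eventually.of_forall hg0⟩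
    exact ht.frequently (Eventually.of_forall hsum).frequently
  have hev := (hps.hasFPowerSeriesAt.analyticAt.frequently_zero_iff_eventually_zero).mp hfreq
  have hp0 : p = 0 := hps.hasFPowerSeriesAt.eq_formalMultilinearSeries_of_eventually
    (hasFPowerSeriesAt_const (c := (0 : ℂ)) (e := (0:ℂ))) hev |>.trans (by ext; simp)
  funext i
  have := congrArg (fun q => q.coeff i) hp0
  rw [hp, FormalMultilinearSeries.coeff_ofScalars] at this
  rw [this]; rfl

/-! ### Closed form through binomial coefficients -/

/-- The binomial coefficient `C(a + b, a)`, extended by zero to negative arguments. -/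
def latticePaths (a b : ℤ) : ℤ :=
  if 0 ≤ a ∧ 0 ≤ b then ((a + b).toNat.choose a.toNat : ℤ) else 0

theorem latticePaths_natCast (a b : ℕ) : latticePaths a b = ((a + b).choose a : ℕ) := by
  have h : ((a : ℤ) + b).toNat = a + b := by omega
  rw [latticePaths, if_pos (by omega), h, Int.toNat_natCast]

theorem latticePaths_of_neg {a b : ℤ} (h : a < 0 ∨ b < 0) : latticePaths a b = 0 :=
  if_neg (by omega)

theorem latticePaths_pascal {a b : ℤ} (h : a ≠ 0 ∨ b ≠ 0) :
    latticePaths a b = latticePaths (a - 1) b + latticePaths a (b - 1) := by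
  by_cases hab : 0 ≤ a ∧ 0 ≤ b
  · obtain ⟨ha, hb⟩ := hab
    lift a to ℕ using ha
    lift b to ℕ using hb
    rcases a with _ | a
    · rcases b with _ | b
      · simp at h
      · have := latticePaths_natCast 0 (b + 1)
        have h2 := latticePaths_natCast 0 b
        rw [latticePaths_of_neg (a := ((0 : ℕ) : ℤ) - 1) (by simp)]
        simp at *
        rw [this, h2]
    · rcases b with _ | b
      · have := latticePaths_natCast (a + 1) 0
        have h2 := latticePaths_natCast a 0
        rw [latticePaths_of_neg (b := ((0 : ℕ) : ℤ) - 1) (by simp)]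
        simp at *
        rw [this, h2]
      · have e1 := latticePaths_natCast (a + 1) (b + 1)
        have e2 := latticePaths_natCast a (b + 1)
        have e3 := latticePaths_natCast (a + 1) b
        rw [show (((a + 1 : ℕ) : ℤ) - 1) = (a : ℕ) by push_cast; ring,
          show (((b + 1 : ℕ) : ℤ) - 1) = (b : ℕ) by push_cast; ring, e1, e2, e3,
          show a + 1 + (b + 1) = (a + (b + 1)) + 1 by ring, Nat.choose_succ_succ,
          show a + 1 + b = a + (b + 1) by ring]
        push_cast; ring
  · rw [latticePaths_of_neg (by omega), latticePaths_of_neg (by omega),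
      latticePaths_of_neg (by omega)]
    rfl

/-- The factorisation `1 - 3xy - x³ - y³ = (1 - x - y)(1 + x + y + x² - xy + y²)` applied to
binomial coefficients. -/
theorem latticePaths_cubic {a b : ℤ} (h : ¬(0 ≤ a ∧ a ≤ 2 ∧ 0 ≤ b ∧ b ≤ 2)) :
    latticePaths a b = 3 * latticePaths (a - 1) (b - 1) + latticePaths (a - 3) b +
      latticePaths a (b - 3) := by
  -- One Pascal relation per monomial of the cofactor; the excluded square contains every point
  -- whose shift is the origin, where Pascal's rule fails.
  have e1 := latticePaths_pascal (a := a) (b := b) (by omega)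
  have e2 := latticePaths_pascal (a := a - 1) (b := b) (by omega)
  have e3 := latticePaths_pascal (a := a) (b := b - 1) (by omega)
  have e4 := latticePaths_pascal (a := a - 2) (b := b) (by omega)
  have e5 := latticePaths_pascal (a := a) (b := b - 2) (by omega)
  have e6 := latticePaths_pascal (a := a - 1) (b := b - 1) (by omega)
  simp only [sub_sub, Int.reduceAdd] at *
  linear_combination e1 + e2 + e3 + e4 + e5 - e6

/-- The normalised coefficients `2 ^ (1 - 4a) s_{i,j}`, where `a = 2i - j` and `b = 2j - i`. -/
def uWeight (a b : ℤ) : ℤ := latticePaths a b + latticePaths a (b - 1)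

theorem uWeight_of_neg {a b : ℤ} (h : a < 0 ∨ b < 0) : uWeight a b = 0 := by
  rw [uWeight, latticePaths_of_neg h, latticePaths_of_neg (by omega), add_zero]

/-- Since a + 2b = 3j, the hypothesis means j ≥ 3; it keeps (a, b) and (a, b - 1) outside the
exceptional square. -/
theorem uWeight_cubic {a b : ℤ} (h : 9 ≤ a + 2 * b) :
    uWeight a b = 3 * uWeight (a - 1) (b - 1) + uWeight (a - 3) b + uWeight a (b - 3) := by
  have e1 := latticePaths_cubic (a := a) (b := b) (by omega)
  have e2 := latticePaths_cubic (a := a) (b := b - 1) (by omega)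
  simp only [uWeight, sub_sub, Int.reduceAdd] at *
  linear_combination e1 + e2

theorem coeff_uPoly_one (i : ℕ) :
    (uPoly 1).coeff i = if i = 1 then 24 else if i = 2 then 2 ^ 11 else 0 := by
  have h : uPoly 1 = Polynomial.C 24 * Polynomial.X + Polynomial.C (2 ^ 11) * Polynomial.X ^ 2 := by
    simp only [uPoly, map_pow, map_ofNat]
  rw [h, Polynomial.coeff_add, Polynomial.coeff_C_mul, Polynomial.coeff_C_mul,
    Polynomial.coeff_X, Polynomial.coeff_X_pow]
  split_ifs <;> omega

theorem coeff_uPoly_one_eq (i : ℕ) : ((uPoly 1).coeff i : ℚ) =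
    2 ^ (4 * (2 * (i : ℤ) - 1) - 1) * uWeight (2 * i - 1) (2 - i) := by
  rw [coeff_uPoly_one]
  rcases i with _ | _ | _ | i
  · rw [uWeight_of_neg (by simp)]; simp
  · have : uWeight 1 1 = 3 := by decide
    norm_num [this]
  · have : uWeight 3 0 = 1 := by decide
    norm_num [this]
  · rw [uWeight_of_neg (by push_cast; omega)]; simp

theorem coeff_uPoly_two_eq (i : ℕ) : ((uPoly 2).coeff i : ℚ) =
    2 ^ (4 * (2 * (i : ℤ) - 2) - 1) * uWeight (2 * i - 2) (4 - i) := by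
  rcases i with _ | _ | i
  · rw [coeff_uPoly_add_one_zero, uWeight_of_neg (by simp)]; simp
  · have : uWeight 0 3 = 2 := by decide
    rw [coeff_uPoly_add_two_one, coeff_uPoly_add_one_zero]
    norm_num [this, uPoly]
  · rw [coeff_uPoly_add_two, coeff_uPoly_one, coeff_uPoly_one, uPoly, Polynomial.coeff_one]
    rcases i with _ | _ | _ | i
    · have : uWeight 2 2 = 9 := by decide
      norm_num [this]
    · have : uWeight 4 1 = 6 := by decide
      norm_num [this]
    · have : uWeight 6 0 = 1 := by decide
      norm_num [this]
    · rw [uWeight_of_neg (by push_cast; omega)]; simp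

/-- The induction starts from exponents 1 and 2 because exponent 0 does not fit: at i = j = 0 the
formula would give 1/2, not 1. -/
theorem coeff_uPoly (j i : ℕ) : ((uPoly (j + 1)).coeff i : ℚ) =
    2 ^ (4 * (2 * (i : ℤ) - (j + 1)) - 1) * uWeight (2 * i - (j + 1)) (2 * (j + 1) - i) := by
  induction j using Nat.twoStepInduction generalizing i with
  | zero => simpa using coeff_uPoly_one_eq i
  | one => simpa using coeff_uPoly_two_eq i
  | more j h0 h1 =>
    rcases i with _ | _ | i
    · rw [coeff_uPoly_add_one_zero, uWeight_of_neg (by push_cast; omega)]; simp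
    · rw [coeff_uPoly_add_two_one, coeff_uPoly_add_one_zero, coeff_uPoly_add_one_zero,
        uWeight_of_neg (by push_cast; omega)]
      simp
    · rw [coeff_uPoly_add_two (j := j + 1)]
      push_cast
      rw [h0, h1, h1]
      push_cast
      -- The three terms of the recurrence lower (a, b) by (1, 1), (3, 0) and (0, 3); rescaling by
      -- 2^(4a-1) turns 48, 2¹², 1 into 3, 1, 1.
      obtain ⟨a, ha⟩ : ∃ a : ℤ, a = 2 * (i + 2) - (j + 3) := ⟨_, rfl⟩
      obtain ⟨b, hb⟩ : ∃ b : ℤ, b = 2 * (j + 3) - (i + 2) := ⟨_, rfl⟩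
      have h2 : (2 : ℚ) ≠ 0 := two_ne_zero
      rw [show 2 * ((i : ℤ) + 1) - (j + 1 + 1) = a - 1 by omega,
        show 2 * ((j : ℤ) + 1 + 1) - (i + 1) = b - 1 by omega,
        show 2 * (i : ℤ) - (j + 1 + 1) = a - 3 by omega,
        show 2 * ((j : ℤ) + 1 + 1) - i = b by omega,
        show 2 * ((i : ℤ) + 1) - (j + 1) = a by omega,
        show 2 * ((j : ℤ) + 1) - (i + 1) = b - 3 by omega,
        show 2 * ((i : ℤ) + 1 + 1) - (j + 2 + 1) = a by omega,
        show 2 * ((j : ℤ) + 2 + 1) - (i + 1 + 1) = b by omega,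
        uWeight_cubic (a := a) (b := b) (by omega),
        show 4 * (a - 1) - 1 = (4 * a - 1) - 4 by ring,
        show 4 * (a - 3) - 1 = (4 * a - 1) - 12 by ring,
        zpow_sub₀ h2, zpow_sub₀ h2 (4 * a - 1) 12]
      push_cast
      ring

theorem choose_add_mul_factorial (a b : ℕ) : (((a + b).choose a : ℕ) : ℚ) * (a ! * b !) = (a + b)! := by
  have := Nat.add_choose_mul_factorial_mul_factorial a b
  rw [← Nat.choose_symm_add] at this
  rw [← mul_assoc]
  exact_mod_cast this

/-- Over the common denominator a! b! the two binomials contribute (a + b) and b times (a+b-1)!. The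
factor a + 2b is the 3j of the final formula. -/
theorem uWeight_natCast {a b : ℕ} (h : 0 < a + b) :
    (uWeight a b : ℚ) = (a + b - 1)! * (a + 2 * b) / (a ! * b !) := by
  have h1 : (a ! * b ! : ℚ) ≠ 0 := by positivity
  rw [eq_div_iff h1, uWeight]
  rcases b with _ | b
  · obtain ⟨a, rfl⟩ := Nat.exists_eq_succ_of_ne_zero (by omega : a ≠ 0)
    rw [latticePaths_of_neg (b := ((0 : ℕ) : ℤ) - 1) (by simp), latticePaths_natCast]
    simp [Nat.factorial_succ]
    ring
  · rw [show ((b + 1 : ℕ) : ℤ) - 1 = (b : ℕ) by push_cast; ring, latticePaths_natCast,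
      latticePaths_natCast]
    have e1 := choose_add_mul_factorial a (b + 1)
    have e2 := choose_add_mul_factorial a b
    have e3 : ((a + (b + 1))! : ℚ) = (a + b + 1) * (a + b)! := by
      rw [← add_assoc, Nat.factorial_succ]; push_cast; ring
    have e4 : ((b + 1)! : ℚ) = (b + 1) * b ! := by
      rw [Nat.factorial_succ]; push_cast; ring
    rw [show a + (b + 1) - 1 = a + b by omega]
    rw [e3] at e1
    rw [e4] at e1 ⊢
    push_cast
    linear_combination e1 + (b + 1) * e2

theorem coeff_uPoly_eq {i j : ℕ} (hi : 1 ≤ i) (hj : 1 ≤ j) (hij : i ≤ 2 * j) (hji : j ≤ 2 * i) :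
    ((uPoly j).coeff i : ℚ) =
      ((i + j - 1)! : ℚ) * (3 * (j : ℚ)) * (2 : ℚ) ^ (8 * (i : ℤ) - 4 * (j : ℤ) - 1) /
        (((2 * i - j)! : ℚ) * ((2 * j - i)! : ℚ)) := by
  obtain ⟨k, rfl⟩ : ∃ k, j = k + 1 := ⟨j - 1, by omega⟩
  obtain ⟨a, ha⟩ : ∃ a, a = 2 * i - (k + 1) := ⟨_, rfl⟩
  obtain ⟨b, hb⟩ : ∃ b, b = 2 * (k + 1) - i := ⟨_, rfl⟩
  rw [coeff_uPoly, ← ha, ← hb, show 2 * (i : ℤ) - (k + 1) = a by omega,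
    show 2 * ((k : ℤ) + 1) - i = b by omega, uWeight_natCast (by omega),
    show i + (k + 1) - 1 = a + b - 1 by omega,
    show 8 * (i : ℤ) - 4 * ((k + 1 : ℕ) : ℤ) - 1 = 4 * a - 1 by omega]
  have : 3 * ((k + 1 : ℕ) : ℚ) = a + 2 * b := by
    have : 3 * (k + 1) = a + 2 * b := by omega
    exact_mod_cast this
  rw [this]
  ring

/-! ### Assembly -/

theorem operatorU_hauptmodul_pow (j : ℕ) (τ : ℍ) :
    operatorU (hauptmodul ^ j) τ = Polynomial.aeval (hauptmodul τ) (uPoly j) :=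
  (aeval_uPoly (operatorU_hauptmodul τ) (hauptmodul_halfTau_mul τ) j).symm

theorem isUCoeff_coeff_uPoly : IsUCoeff fun i j => (((uPoly j).coeff i : ℤ) : ℂ) := fun j τ => by
  rw [operatorU_hauptmodul_pow]
  exact hasSum_coeff_mul_pow _ _

theorem IsUCoeff.unique {s t : ℕ → ℕ → ℂ} (hs : IsUCoeff s) (ht : IsUCoeff t) : t = s := by
  have h (j : ℕ) : (fun i => t i j - s i j) = 0 :=
    eq_zero_of_hasSum_of_frequently tendsto_hauptmodul hauptmodul_ne_zero fun τ => by
      simpa [sub_mul] using (ht j τ).sub (hs j τ)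
  funext i j
  exact sub_eq_zero.mp (congrFun (h j) i)

theorem mainTheorem7 :
    operatorU hauptmodul = (fun τ : ℍ => 24 * hauptmodul τ + 2 ^ 11 * hauptmodul τ ^ 2) ∧
    (∀ τ : ℍ, hauptmodul (halfTau τ) * hauptmodul (halfTauAddOne τ) = -hauptmodul τ) ∧
    ∃ s : ℕ → ℕ → ℤ,
      IsUCoeff (fun i j => (s i j : ℂ)) ∧
      (∀ t : ℕ → ℕ → ℂ, IsUCoeff t → t = fun i j => (s i j : ℂ)) ∧
      (∀ i j : ℕ, 2 ≤ i → 2 ≤ j →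
        s i j = 48 * s (i - 1) (j - 1) + 2 ^ 12 * s (i - 2) (j - 1) + s (i - 1) (j - 2)) ∧
      (∀ i j : ℕ, 1 ≤ i → 1 ≤ j → i ≤ 2 * j → j ≤ 2 * i →
        (s i j : ℚ) =
          ((i + j - 1)! : ℚ) * (3 * (j : ℚ)) * (2 : ℚ) ^ (8 * (i : ℤ) - 4 * (j : ℤ) - 1) /
            (((2 * i - j)! : ℚ) * ((2 * j - i)! : ℚ))) := by
  refine ⟨funext operatorU_hauptmodul, hauptmodul_halfTau_mul, fun i j => (uPoly j).coeff i,
    isUCoeff_coeff_uPoly, fun t ht => isUCoeff_coeff_uPoly.unique ht, fun i j hi hj => ?_,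
    fun i j hi hj hij hji => coeff_uPoly_eq hi hj hij hji⟩
  obtain ⟨i, rfl⟩ := Nat.exists_eq_add_of_le' hi
  obtain ⟨j, rfl⟩ := Nat.exists_eq_add_of_le' hj
  exact coeff_uPoly_add_two i j
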